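/- Let $\Bbbk$ be a unital commutative ring, $A$ a unital associative $\Bbbk$-algebra, and $\Omega_d^\bullet$ an exterior algebra over $A$, that is, a differential graded $\Bbbk$-algebra with $\Omega_d^0=A$ that is generated as an algebra by $A$ and $dA$. Let $J_d^1A=(A\otimes_{\Bbbk}A)/N_d$, where $N_d=\{\sum a_i\otimes b_i:\sum a_ib_i=0,\ \sum a_i\,db_i=0\}$, let $J_d^1M=J_d^1A\otimes_AM$ and $j_d^1(m)=[1\otimes 1]\otimes m$ for a left $A$-module $M$. The holonomic jet modules are $J_d^0M=M$, $J_d^1M$ and, for $n\ge 2$, $J_d^nM\subseteq J_d^1J_d^{n-1}M$ is the kernel of $\widetilde{\mathbb D}\circ J_d^1(l^{n-1})$, where $l^{n-1}:J_d^{n-1}M\to J_d^1J_d^{n-2}M$ is the inclusion (the identity for $n=2$) and $$\widetilde{\mathbb D}:J_d^1J_d^1P\to(\Omega_d^1\otimes_AP)\times(\Omega_d^2\otimes_AP),\qquad [a\otimes b]\otimes[c\otimes f]\otimes p\mapsto\bigl(a\,d(bc)f\otimes p,\ da\wedge d(bc)f\otimes p\bigr);$$ the prolongations are $j_d^0=\mathrm{id}$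 and $j_d^n=j_d^1\circ j_d^{n-1}:M\to J_d^nM$. For left $A$-modules $E,F$, a linear differential operator $E\to F$ of order at most $n$ is a $\Bbbk$-linear map of the form $\tilde\Delta\circ j_d^n$ with $\tilde\Delta:J_d^nE\to F$ an $A$-linear map; these form $\mathrm{Diff}_d^n(E,F)$. Put $\mathrm{Diff}_d^{-1}(E,F)=0$, $\mathrm{Diff}_d(E,F)=\bigcup_n\mathrm{Diff}_d^n(E,F)$, $\mathrm{Symb}_d^n(E,F)=\mathrm{Diff}_d^n(E,F)/\mathrm{Diff}_d^{n-1}(E,F)$ with quotient map $\varsigma^n$, and $\mathrm{Symb}_d^\bullet(E,F)=\bigoplus_{n\ge0}\mathrm{Symb}_d^n(E,F)$. The symbol algebra is $\mathrm{Symb}_d^\bullet(E,E)$ with the product $\varsigma^n(\Delta_1)\cdot\varsigma^m(\Delta_2)=\varsigma^{n+m}(\Delta_1\circ\Delta_2)$ and unit $\varsigma^0(\mathrm{id}_E)$. Let $E$ be a left $A$-module and let $q=\sum_nq^n:\mathrm{Symb}_d^\bullet(E,E)\to\mathrm{Diff}_d(E,E)$ be a full quantization for $(E,E)$: every $q^n:\mathrm{Symb}_d^n(E,E)\to\mathrm{Diff}_d^n(E,E)$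 is ${}_A\mathrm{Hom}(E,E)$-linear (for the action by composition on the left) and $\varsigma^n\circ q^n=\mathrm{id}$. For $\Delta\in\mathrm{Diff}_d^N(E,E)$ let $T^k=\Delta$ for $k\ge N$, let $T^k=T^{k+1}-q^{k+1}(\varsigma^{k+1}(T^{k+1}))$ for $0\le k<N$, and let $[\Delta]_q^k=\varsigma^k(T^k)$. For $\hbar\in\Bbbk$ let $\star_\hbar$ be the $\Bbbk$-bilinear operation on $\mathrm{Symb}_d^\bullet(E,E)$ with $$a\star_\hbar b=\sum_{k=0}^{n+m}\hbar^k\,[q^n(a)\circ q^m(b)]_q^{n+m-k}\qquad(a\in\mathrm{Symb}_d^n(E,E),\ b\in\mathrm{Symb}_d^m(E,E)).$$ Then: (i) $(\mathrm{Symb}_d^\bullet(E,E),\star_0)=(\mathrm{Symb}_d^\bullet(E,E),\cdot)$, that is, $a\star_0b=a\cdot b$ for all $a,b\in\mathrm{Symb}_d^\bullet(E,E)$. (ii) The map $q$ is an isomorphism of unital $\Bbbk$-algebras $(\mathrm{Symb}_d^\bullet(E,E),\star_1)\cong(\mathrm{Diff}_d(E,E),\circ)$: it is $\Bbbk$-linear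 and bijective, $q(a\star_1b)=q(a)\circ q(b)$ for all $a,b\in\mathrm{Symb}_d^\bullet(E,E)$, and $q(\varsigma^0(\mathrm{id}_E))=\mathrm{id}_E$. -/

import Mathlib

universe u v w x y

noncomputable section

open scoped TensorProduct DirectSum

set_option linter.unusedSectionVars false

namespace NCDiff

section BalancedTensor

/-- The relations `(x · a) ⊗ m = x ⊗ (a · m)` that define `X ⊗_A M` as a quotient of `X ⊗_ℤ M`. -/
def balancedRel (A : Type u) (X : Type v) (M : Type w) [Ring A] [AddCommGroup X] [Module A X]
    [Module Aᵐᵒᵖ X] [SMulCommClass A Aᵐᵒᵖ X] [AddCommGroup M] [Module A M] :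
    Submodule A (X ⊗[ℤ] M) :=
  Submodule.span A {t | ∃ (x : X) (a : A) (m : M),
    t = (MulOpposite.op a • x) ⊗ₜ[ℤ] m - x ⊗ₜ[ℤ] (a • m)}

/-- The tensor product `X ⊗_A M` of an `A`-bimodule `X` and a left `A`-module `M` over a
not necessarily commutative ring `A`, as a left `A`-module.  (The `A`-span in the relations is the
additive span, because `a' • ((x · a) ⊗ m - x ⊗ (a • m))` is again such a relation.) -/
def BTensor (A : Type u) (X : Type v) (M : Type w) [Ring A] [AddCommGroup X] [Module A X]
    [Module Aᵐᵒᵖ X] [SMulCommClass A Aᵐᵒᵖ X] [AddCommGroup M] [Module A M] : Type (max v w) :=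
  (X ⊗[ℤ] M) ⧸ balancedRel A X M

variable {A : Type u} {X : Type v} {M : Type w} [Ring A] [AddCommGroup X] [Module A X]
    [Module Aᵐᵒᵖ X] [SMulCommClass A Aᵐᵒᵖ X] [AddCommGroup M] [Module A M]

instance : AddCommGroup (BTensor A X M) :=
  inferInstanceAs (AddCommGroup ((X ⊗[ℤ] M) ⧸ balancedRel A X M))

instance : Module A (BTensor A X M) :=
  inferInstanceAs (Module A ((X ⊗[ℤ] M) ⧸ balancedRel A X M))

/-- The class of `x ⊗ m` in `X ⊗_A M`. -/
def BTensor.tmul (x : X) (m : M) : BTensor A X M :=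
  (balancedRel A X M).mkQ (x ⊗ₜ[ℤ] m)

theorem BTensor.tmul_add (x : X) (m m' : M) :
    BTensor.tmul (A := A) x (m + m') = BTensor.tmul x m + BTensor.tmul x m' := by
  simp only [BTensor.tmul, TensorProduct.tmul_add, map_add]; rfl

theorem BTensor.add_tmul (x x' : X) (m : M) :
    BTensor.tmul (A := A) (x + x') m = BTensor.tmul x m + BTensor.tmul x' m := by
  simp only [BTensor.tmul, TensorProduct.add_tmul, map_add]; rfl

theorem BTensor.smul_tmul (a : A) (x : X) (m : M) :
    a • BTensor.tmul (A := A) x m = BTensor.tmul (a • x) m := by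
  simp only [BTensor.tmul, ← TensorProduct.smul_tmul', map_smul]; rfl

theorem BTensor.op_smul_tmul (a : A) (x : X) (m : M) :
    BTensor.tmul (A := A) (MulOpposite.op a • x) m = BTensor.tmul x (a • m) := by
  refine (Submodule.Quotient.eq (balancedRel A X M)).2 ?_
  exact Submodule.subset_span ⟨x, a, m, rfl⟩

theorem BTensor.induction {p : BTensor A X M → Prop} (h0 : p 0)
    (ht : ∀ x m, p (BTensor.tmul x m)) (ha : ∀ s t, p s → p t → p (s + t)) (t : BTensor A X M) :
    p t := by
  obtain ⟨t, rfl⟩ := (balancedRel A X M).mkQ_surjective t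
  induction t using TensorProduct.induction_on with
  | zero => rw [map_zero]; exact h0
  | tmul x m => exact ht x m
  | add s t hs ht => rw [map_add]; exact ha _ _ hs ht

/-- Additive maps out of `X ⊗_A M` from balanced biadditive maps. -/
def BTensor.lift {P : Type x} [AddCommGroup P] (f : X →+ M →+ P)
    (hf : ∀ (x : X) (a : A) (m : M), f (MulOpposite.op a • x) m = f x (a • m)) :
    BTensor A X M →+ P :=
  QuotientAddGroup.lift (balancedRel A X M).toAddSubgroup
    (TensorProduct.liftAddHom (R := ℤ) f (fun r x m => by simp)) (by
      intro t ht
      have key : ∀ t ∈ balancedRel A X M, ∀ c : A,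
          TensorProduct.liftAddHom (R := ℤ) f (fun r x m => by simp) (c • t) = 0 := by
        intro t ht
        induction ht using Submodule.span_induction with
        | mem t h =>
          obtain ⟨x, a, m, rfl⟩ := h
          intro c
          rw [smul_sub, TensorProduct.smul_tmul', TensorProduct.smul_tmul', map_sub,
            TensorProduct.liftAddHom_tmul, TensorProduct.liftAddHom_tmul, smul_comm, hf, sub_self]
        | zero => intro c; rw [smul_zero, map_zero]
        | add s t _ _ hs ht => intro c; rw [smul_add, map_add, hs, ht, add_zero]
        | smul b t _ ht => intro c; rw [smul_smul]; exact ht _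
      have := key t ht 1
      rwa [one_smul] at this)

@[simp] theorem BTensor.lift_tmul {P : Type x} [AddCommGroup P] (f : X →+ M →+ P)
    (hf : ∀ (x : X) (a : A) (m : M), f (MulOpposite.op a • x) m = f x (a • m)) (x : X) (m : M) :
    BTensor.lift f hf (BTensor.tmul x m) = f x m :=
  TensorProduct.liftAddHom_tmul (R := ℤ) f (fun r x m => by simp) x m

/-- `x ↦ m ↦ x ⊗ m` as a biadditive map. -/
def BTensor.mk (A : Type u) (X : Type v) (M : Type w) [Ring A] [AddCommGroup X] [Module A X]
    [Module Aᵐᵒᵖ X] [SMulCommClass A Aᵐᵒᵖ X] [AddCommGroup M] [Module A M] :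
    X →+ M →+ BTensor A X M :=
  AddMonoidHom.mk' (fun x => AddMonoidHom.mk' (fun m => BTensor.tmul x m) (BTensor.tmul_add x))
    (fun x x' => by ext m; exact BTensor.add_tmul x x' m)

@[simp] theorem BTensor.mk_apply (x : X) (m : M) : BTensor.mk A X M x m = BTensor.tmul x m := rfl

/-- The additive map `X ⊗_A f`. -/
def BTensor.mapAux (X : Type v) [AddCommGroup X] [Module A X]
    [Module Aᵐᵒᵖ X] [SMulCommClass A Aᵐᵒᵖ X] {N : Type y} [AddCommGroup N] [Module A N]
    (f : M →ₗ[A] N) : BTensor A X M →+ BTensor A X N :=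
  BTensor.lift
    (AddMonoidHom.mk' (fun x => (BTensor.mk A X N x).comp f.toAddMonoidHom)
      (fun x x' => by ext m; simp))
    (fun x a m => by simp [BTensor.op_smul_tmul])

theorem BTensor.mapAux_tmul {N : Type y} [AddCommGroup N] [Module A N]
    (f : M →ₗ[A] N) (x : X) (m : M) :
    BTensor.mapAux X f (BTensor.tmul x m) = BTensor.tmul x (f m) := by
  rw [BTensor.mapAux]
  exact Eq.trans (BTensor.lift_tmul _ _ _ _) rfl

/-- The `A`-linear map `X ⊗_A f`. -/
def BTensor.map (X : Type v) [AddCommGroup X] [Module A X]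
    [Module Aᵐᵒᵖ X] [SMulCommClass A Aᵐᵒᵖ X] {N : Type y} [AddCommGroup N] [Module A N]
    (f : M →ₗ[A] N) : BTensor A X M →ₗ[A] BTensor A X N where
  toFun := BTensor.mapAux X f
  map_add' := map_add _
  map_smul' a t := by
    induction t using BTensor.induction with
    | h0 => simp
    | ht x m =>
      rw [BTensor.smul_tmul, BTensor.mapAux_tmul, BTensor.mapAux_tmul, RingHom.id_apply,
        BTensor.smul_tmul]
    | ha s t hs ht => rw [smul_add, map_add, hs, ht, map_add, smul_add]

@[simp] theorem BTensor.map_tmul {N : Type y} [AddCommGroup N] [Module A N]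
    (f : M →ₗ[A] N) (x : X) (m : M) :
    BTensor.map X f (BTensor.tmul x m) = BTensor.tmul x (f m) :=
  BTensor.mapAux_tmul f x m

end BalancedTensor

section Calculus

/-- An exterior algebra over the unital associative `k`-algebra `A`: a differential graded algebra
`Ω = ⨁ Ωⁿ` over `k` with `Ω⁰ = A`, generated as an algebra by `A` and `dA`. -/
structure ExtAlg (k : Type w) (A : Type u) (Ω : Type v) [CommRing k] [Ring A] [Algebra k A]
    [Ring Ω] [Algebra k Ω] where
  /-- the homogeneous components `Ωⁿ` -/
  gr : ℕ → Submodule k Ω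
  gradedMonoid : SetLike.GradedMonoid gr
  isInternal : DirectSum.IsInternal gr
  /-- the identification of `A` with `Ω⁰` -/
  base : A →ₐ[k] Ω
  base_injective : Function.Injective base
  range_base : LinearMap.range base.toLinearMap = gr 0
  /-- the exterior derivative -/
  d : Ω →ₗ[k] Ω
  d_mem : ∀ (n : ℕ) (x : Ω), x ∈ gr n → d x ∈ gr (n + 1)
  d_d : ∀ x : Ω, d (d x) = 0
  leibniz : ∀ (n : ℕ) (x y : Ω), x ∈ gr n → d (x * y) = d x * y + (-1) ^ n * (x * d y)
  generated : Algebra.adjoin k (Set.range base ∪ Set.range fun a => d (base a)) = ⊤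

variable {k : Type w} {A : Type u} {Ω : Type v} [CommRing k] [Ring A] [Algebra k A]
    [Ring Ω] [Algebra k Ω] (Γ : ExtAlg k A Ω)

namespace ExtAlg

theorem base_mem (a : A) : Γ.base a ∈ Γ.gr 0 := by
  rw [← Γ.range_base]; exact ⟨a, rfl⟩

theorem base_mul_mem {n : ℕ} (a : A) {x : Ω} (hx : x ∈ Γ.gr n) : Γ.base a * x ∈ Γ.gr n := by
  have := Γ.gradedMonoid.mul_mem (Γ.base_mem a) hx
  rwa [zero_add] at this

theorem mul_base_mem {n : ℕ} (a : A) {x : Ω} (hx : x ∈ Γ.gr n) : x * Γ.base a ∈ Γ.gr n := by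
  have := Γ.gradedMonoid.mul_mem hx (Γ.base_mem a)
  rwa [add_zero] at this

theorem d_base_mul (a b : A) :
    Γ.d (Γ.base (a * b)) = Γ.d (Γ.base a) * Γ.base b + Γ.base a * Γ.d (Γ.base b) := by
  rw [map_mul, Γ.leibniz 0 _ _ (Γ.base_mem a), pow_zero, one_mul]

theorem d_one : Γ.d 1 = 0 := by
  have := Γ.d_base_mul 1 1
  simpa using this

/-- The `A`-bimodule `Ωⁿ` of `n`-forms. -/
def Form (n : ℕ) : Type v := ↥(Γ.gr n)

instance (n : ℕ) : AddCommGroup (Γ.Form n) := inferInstanceAs (AddCommGroup ↥(Γ.gr n))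

/-- The underlying element of `Ω`. -/
def Form.val {n : ℕ} : Γ.Form n →+ Ω := (Γ.gr n).subtype.toAddMonoidHom

theorem Form.ext {n : ℕ} {x y : Γ.Form n} (h : Form.val Γ x = Form.val Γ y) : x = y :=
  Subtype.ext h

/-- An element of `Ω` that lies in degree `n`, as an `n`-form. -/
def Form.of {n : ℕ} (x : Ω) (hx : x ∈ Γ.gr n) : Γ.Form n := ⟨x, hx⟩

@[simp] theorem Form.val_of {n : ℕ} (x : Ω) (hx : x ∈ Γ.gr n) :
    Form.val Γ (Form.of Γ x hx) = x := rfl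

theorem Form.val_mem {n : ℕ} (x : Γ.Form n) : Form.val Γ x ∈ Γ.gr n := x.2

instance (n : ℕ) : Module A (Γ.Form n) where
  smul a x := Form.of Γ (Γ.base a * Form.val Γ x) (Γ.base_mul_mem a x.2)
  one_smul x := Form.ext Γ (by change Γ.base 1 * _ = _; simp)
  mul_smul a b x := Form.ext Γ (by
    change Γ.base (a * b) * _ = Γ.base a * (Γ.base b * _); simp [mul_assoc])
  smul_zero a := Form.ext Γ (by change Γ.base a * Form.val Γ 0 = Form.val Γ 0; simp)
  smul_add a x y := Form.ext Γ (by
    change Γ.base a * Form.val Γ (x + y) = Γ.base a * Form.val Γ x + Γ.base a * Form.val Γ y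
    simp [mul_add])
  add_smul a b x := Form.ext Γ (by
    change Γ.base (a + b) * Form.val Γ x = Γ.base a * Form.val Γ x + Γ.base b * Form.val Γ x
    simp [add_mul])
  zero_smul x := Form.ext Γ (by change Γ.base 0 * Form.val Γ x = Form.val Γ 0; simp)

instance (n : ℕ) : Module Aᵐᵒᵖ (Γ.Form n) where
  smul a x := Form.of Γ (Form.val Γ x * Γ.base a.unop) (Γ.mul_base_mem a.unop x.2)
  one_smul x := Form.ext Γ (by change _ * Γ.base 1 = _; simp)
  mul_smul a b x := Form.ext Γ (by
    change _ * Γ.base (b.unop * a.unop) = _ * Γ.base b.unop * Γ.base a.unop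
    rw [map_mul, mul_assoc])
  smul_zero a := Form.ext Γ (by change Form.val Γ 0 * Γ.base a.unop = Form.val Γ 0; simp)
  smul_add a x y := Form.ext Γ (by
    change Form.val Γ (x + y) * Γ.base a.unop
      = Form.val Γ x * Γ.base a.unop + Form.val Γ y * Γ.base a.unop
    simp [add_mul])
  add_smul a b x := Form.ext Γ (by
    change Form.val Γ x * Γ.base (a.unop + b.unop)
      = Form.val Γ x * Γ.base a.unop + Form.val Γ x * Γ.base b.unop
    simp [mul_add])
  zero_smul x := Form.ext Γ (by change Form.val Γ x * Γ.base 0 = Form.val Γ 0; simp)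

@[simp] theorem Form.val_smul {n : ℕ} (a : A) (x : Γ.Form n) :
    Form.val Γ (a • x) = Γ.base a * Form.val Γ x := rfl

@[simp] theorem Form.val_op_smul {n : ℕ} (a : A) (x : Γ.Form n) :
    Form.val Γ (MulOpposite.op a • x) = Form.val Γ x * Γ.base a := rfl

instance (n : ℕ) : SMulCommClass A Aᵐᵒᵖ (Γ.Form n) where
  smul_comm a b x := Form.ext Γ (by
    change Γ.base a * (Form.val Γ x * Γ.base b.unop) = Γ.base a * Form.val Γ x * Γ.base b.unop
    rw [mul_assoc])

/-- The map `A ⊗ A → Ω¹ ⊆ Ω`, `a ⊗ b ↦ a db`. -/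
def leftD : A ⊗[k] A →ₗ[k] Ω :=
  TensorProduct.lift ((LinearMap.mul k Ω).compl₁₂ Γ.base.toLinearMap (Γ.d ∘ₗ Γ.base.toLinearMap))

@[simp] theorem leftD_tmul (a b : A) : Γ.leftD (a ⊗ₜ b) = Γ.base a * Γ.d (Γ.base b) := rfl

theorem mul'_smul (a : A) (t : A ⊗[k] A) :
    LinearMap.mul' k A (a • t) = a * LinearMap.mul' k A t := by
  induction t using TensorProduct.induction_on with
  | zero => simp
  | tmul x y => simp [TensorProduct.smul_tmul', mul_assoc]
  | add s t hs ht => rw [smul_add, map_add, hs, ht, map_add, mul_add]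

theorem leftD_smul (a : A) (t : A ⊗[k] A) : Γ.leftD (a • t) = Γ.base a * Γ.leftD t := by
  induction t using TensorProduct.induction_on with
  | zero => simp
  | tmul x y => simp [TensorProduct.smul_tmul', mul_assoc]
  | add s t hs ht => rw [smul_add, map_add, hs, ht, map_add, mul_add]

/-- The relations of the `1`-jet bimodule: the kernel of `a ⊗ b ↦ a db` on the universal
`1`-forms `ker (A ⊗ A → A)`. -/
def jetRel : Submodule A (A ⊗[k] A) where
  carrier := {t | LinearMap.mul' k A t = 0 ∧ Γ.leftD t = 0}
  add_mem' {s t} hs ht := ⟨by rw [map_add, hs.1, ht.1, add_zero],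
    by rw [map_add, hs.2, ht.2, add_zero]⟩
  zero_mem' := ⟨map_zero _, map_zero _⟩
  smul_mem' a t ht := ⟨by rw [mul'_smul, ht.1, mul_zero], by rw [leftD_smul, ht.2, mul_zero]⟩

/-- The `A`-bimodule `J¹A = (A ⊗ A) / N` of `1`-jets of `A`. -/
def JetA : Type u := (A ⊗[k] A) ⧸ Γ.jetRel

instance : AddCommGroup Γ.JetA := inferInstanceAs (AddCommGroup ((A ⊗[k] A) ⧸ Γ.jetRel))

instance : Module A Γ.JetA := inferInstanceAs (Module A ((A ⊗[k] A) ⧸ Γ.jetRel))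

/-- The projection `A ⊗ A → J¹A`, `a ⊗ b ↦ [a ⊗ b]`. -/
def JetA.mk : A ⊗[k] A →ₗ[A] Γ.JetA := Γ.jetRel.mkQ

theorem JetA.mk_surjective : Function.Surjective (JetA.mk Γ) := Γ.jetRel.mkQ_surjective

/-- Multiplication by `c` on the right factor of `A ⊗ A`. -/
def rmul (k : Type w) {A : Type u} [CommRing k] [Ring A] [Algebra k A] (c : A) :
    A ⊗[k] A →ₗ[A] A ⊗[k] A :=
  TensorProduct.AlgebraTensorModule.map LinearMap.id (LinearMap.mulRight k c)

@[simp] theorem rmul_tmul (a b c : A) : rmul k c (a ⊗ₜ b) = a ⊗ₜ (b * c) := rfl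

theorem mul'_rmul (c : A) (t : A ⊗[k] A) :
    LinearMap.mul' k A (rmul k c t) = LinearMap.mul' k A t * c := by
  induction t using TensorProduct.induction_on with
  | zero => simp
  | tmul x y => simp [mul_assoc]
  | add s t hs ht => rw [map_add, map_add, hs, ht, map_add, add_mul]

theorem leftD_rmul (c : A) (t : A ⊗[k] A) : Γ.leftD (rmul k c t)
    = Γ.leftD t * Γ.base c + Γ.base (LinearMap.mul' k A t) * Γ.d (Γ.base c) := by
  induction t using TensorProduct.induction_on with
  | zero => simp
  | tmul x y =>
    rw [rmul_tmul, leftD_tmul, d_base_mul, leftD_tmul, LinearMap.mul'_apply, map_mul]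
    noncomm_ring
  | add s t hs ht => simp only [map_add, hs, ht, add_mul]; abel

theorem jetRel_le_comap (c : A) : Γ.jetRel ≤ Γ.jetRel.comap (rmul k c) := fun t ht =>
  ⟨by rw [mul'_rmul, ht.1, zero_mul], by rw [leftD_rmul, ht.1, ht.2]; simp⟩

/-- The right action of `c` on `J¹A`. -/
def JetA.rmul (c : A) : Γ.JetA →ₗ[A] Γ.JetA :=
  Γ.jetRel.mapQ Γ.jetRel (ExtAlg.rmul k c) (Γ.jetRel_le_comap c)

theorem JetA.rmul_mk (c : A) (t : A ⊗[k] A) :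
    JetA.rmul Γ c (JetA.mk Γ t) = JetA.mk Γ (ExtAlg.rmul k c t) := rfl

theorem JetA.induction {p : Γ.JetA → Prop} (h0 : p 0)
    (ht : ∀ a b : A, p (JetA.mk Γ (a ⊗ₜ b))) (ha : ∀ s t, p s → p t → p (s + t)) (t : Γ.JetA) :
    p t := by
  obtain ⟨t, rfl⟩ := JetA.mk_surjective Γ t
  induction t using TensorProduct.induction_on with
  | zero => rw [map_zero]; exact h0
  | tmul x m => exact ht x m
  | add s t hs ht => rw [map_add]; exact ha _ _ hs ht

instance : Module Aᵐᵒᵖ Γ.JetA where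
  smul c x := JetA.rmul Γ c.unop x
  one_smul x := by
    change JetA.rmul Γ 1 x = x
    induction x using JetA.induction with
    | h0 => simp
    | ht a b => simp [JetA.rmul_mk]
    | ha s t hs ht => rw [map_add, hs, ht]
  mul_smul a b x := by
    change JetA.rmul Γ (b.unop * a.unop) x = JetA.rmul Γ a.unop (JetA.rmul Γ b.unop x)
    induction x using JetA.induction with
    | h0 => simp
    | ht a b => simp [JetA.rmul_mk, mul_assoc]
    | ha s t hs ht => rw [map_add, hs, ht, map_add, map_add]
  smul_zero a := map_zero (JetA.rmul Γ a.unop)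
  smul_add a x y := map_add (JetA.rmul Γ a.unop) x y
  add_smul a b x := by
    change JetA.rmul Γ (a.unop + b.unop) x = JetA.rmul Γ a.unop x + JetA.rmul Γ b.unop x
    induction x using JetA.induction with
    | h0 => simp
    | ht a b => simp [JetA.rmul_mk, mul_add, TensorProduct.tmul_add]
    | ha s t hs ht => rw [map_add, hs, ht, map_add, map_add]; abel
  zero_smul x := by
    change JetA.rmul Γ 0 x = 0
    induction x using JetA.induction with
    | h0 => simp
    | ht a b => simp [JetA.rmul_mk]
    | ha s t hs ht => rw [map_add, hs, ht, add_zero]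

theorem JetA.op_smul_mk (c : A) (t : A ⊗[k] A) :
    MulOpposite.op c • JetA.mk Γ t = JetA.mk Γ (ExtAlg.rmul k c t) := rfl

instance : SMulCommClass A Aᵐᵒᵖ Γ.JetA where
  smul_comm a b x := ((JetA.rmul Γ b.unop).map_smul a x).symm

/-- The `1`-jet module `J¹M = J¹A ⊗_A M` of a left `A`-module `M`. -/
abbrev J1 (M : Type y) [AddCommGroup M] [Module A M] : Type (max u y) := BTensor A Γ.JetA M

/-- The `1`-jet prolongation `m ↦ [1 ⊗ 1] ⊗ m`. -/
def j1 (M : Type y) [AddCommGroup M] [Module A M] : M →+ Γ.J1 M :=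
  BTensor.mk A Γ.JetA M (JetA.mk Γ (1 ⊗ₜ 1))

variable {M : Type y} [AddCommGroup M] [Module A M]

theorem tmul_eq (a b : A) (m : M) :
    BTensor.tmul (JetA.mk Γ (a ⊗ₜ b)) m = a • Γ.j1 M (b • m) := by
  change _ = a • BTensor.tmul (JetA.mk Γ (1 ⊗ₜ 1)) (b • m)
  rw [← BTensor.op_smul_tmul, BTensor.smul_tmul, JetA.op_smul_mk, rmul_tmul, ← map_smul,
    TensorProduct.smul_tmul', one_mul, smul_eq_mul, mul_one]

theorem J1.induction {p : Γ.J1 M → Prop} (h0 : p 0) (ht : ∀ (a : A) (m : M), p (a • Γ.j1 M m))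
    (ha : ∀ s t, p s → p t → p (s + t)) (t : Γ.J1 M) : p t := by
  induction t using BTensor.induction with
  | h0 => exact h0
  | ht x m =>
    induction x using JetA.induction with
    | h0 => rw [← BTensor.mk_apply, map_zero]; exact h0
    | ht a b => rw [tmul_eq]; exact ht _ _
    | ha s t hs ht => rw [BTensor.add_tmul]; exact ha _ _ hs ht
  | ha s t hs ht => exact ha _ _ hs ht

theorem J1.hom_ext {N : Type x} [AddCommGroup N] [Module A N] {f g : Γ.J1 M →ₗ[A] N}
    (h : ∀ m, f (Γ.j1 M m) = g (Γ.j1 M m)) : f = g := by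
  ext t
  induction t using J1.induction with
  | h0 => simp
  | ht a m => rw [map_smul, map_smul, h]
  | ha s t hs ht => rw [map_add, map_add, hs, ht]

/-- The functor `J¹` on morphisms. -/
abbrev J1.map {N : Type x} [AddCommGroup N] [Module A N] (f : M →ₗ[A] N) : Γ.J1 M →ₗ[A] Γ.J1 N :=
  BTensor.map Γ.JetA f

theorem J1.map_j1 {N : Type x} [AddCommGroup N] [Module A N] (f : M →ₗ[A] N) (m : M) :
    J1.map Γ f (Γ.j1 M m) = Γ.j1 N (f m) :=
  BTensor.map_tmul f _ m

/-- The bimodule projection `J¹A → A`, `[a ⊗ b] ↦ ab`. -/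
def JetA.proj : Γ.JetA →+ A :=
  QuotientAddGroup.lift Γ.jetRel.toAddSubgroup (LinearMap.mul' k A).toAddMonoidHom
    (fun _ ht => ht.1)

@[simp] theorem JetA.proj_mk (t : A ⊗[k] A) :
    JetA.proj Γ (JetA.mk Γ t) = LinearMap.mul' k A t := rfl

theorem JetA.proj_smul (a : A) (t : Γ.JetA) : JetA.proj Γ (a • t) = a * JetA.proj Γ t := by
  obtain ⟨t, rfl⟩ := JetA.mk_surjective Γ t
  rw [← map_smul]; exact mul'_smul a t

theorem JetA.proj_op_smul (a : A) (t : Γ.JetA) :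
    JetA.proj Γ (MulOpposite.op a • t) = JetA.proj Γ t * a := by
  obtain ⟨t, rfl⟩ := JetA.mk_surjective Γ t
  exact mul'_rmul a t

/-- The additive map `J¹M → M`, `[a ⊗ b] ⊗ m ↦ abm`. -/
def projAux (M : Type y) [AddCommGroup M] [Module A M] : Γ.J1 M →+ M :=
  BTensor.lift ((smulAddHom A M).comp (JetA.proj Γ)) (fun t a m => by
    simp only [AddMonoidHom.comp_apply, smulAddHom_apply, JetA.proj_op_smul, mul_smul])

theorem projAux_tmul (t : Γ.JetA) (m : M) :
    Γ.projAux M (BTensor.tmul t m) = JetA.proj Γ t • m := by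
  rw [projAux]
  exact Eq.trans (BTensor.lift_tmul _ _ _ _) rfl

/-- The jet projection `π^{1,0} : J¹M → M`, `[a ⊗ b] ⊗ m ↦ abm`. -/
def proj (M : Type y) [AddCommGroup M] [Module A M] : Γ.J1 M →ₗ[A] M where
  toFun := Γ.projAux M
  map_add' := map_add _
  map_smul' a t := by
    induction t using BTensor.induction with
    | h0 => simp
    | ht x m =>
      rw [BTensor.smul_tmul, projAux_tmul, projAux_tmul, JetA.proj_smul, mul_smul,
        RingHom.id_apply]
    | ha s t hs ht => rw [smul_add, map_add, hs, ht, map_add, smul_add]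

theorem proj_tmul (t : Γ.JetA) (m : M) : Γ.proj M (BTensor.tmul t m) = JetA.proj Γ t • m :=
  Γ.projAux_tmul t m

@[simp] theorem proj_j1 (m : M) : Γ.proj M (Γ.j1 M m) = m := by
  change Γ.proj M (BTensor.tmul (JetA.mk Γ (1 ⊗ₜ 1)) m) = m
  rw [proj_tmul]; simp

/-- The differential `A → Ω¹`. -/
def dForm : A →+ Γ.Form 1 where
  toFun a := Form.of Γ (Γ.d (Γ.base a)) (Γ.d_mem 0 _ (Γ.base_mem a))
  map_zero' := Form.ext Γ (by simp)
  map_add' a b := Form.ext Γ (by simp)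

@[simp] theorem val_dForm (a : A) : Form.val Γ (Γ.dForm a) = Γ.d (Γ.base a) := rfl

/-- For `ω ∈ Ω`, the map `A ⊗ A → Ω`, `y ⊗ z ↦ d(ωy) z`. -/
def spencerAux (ω : Ω) : A ⊗[k] A →ₗ[k] Ω :=
  TensorProduct.lift ((LinearMap.mul k Ω).compl₁₂
    (Γ.d ∘ₗ LinearMap.mulLeft k ω ∘ₗ Γ.base.toLinearMap) Γ.base.toLinearMap)

@[simp] theorem spencerAux_tmul (ω : Ω) (y z : A) :
    Γ.spencerAux ω (y ⊗ₜ z) = Γ.d (ω * Γ.base y) * Γ.base z := rfl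

theorem spencerAux_eq {m : ℕ} {ω : Ω} (hω : ω ∈ Γ.gr m) (t : A ⊗[k] A) :
    Γ.spencerAux ω t = Γ.d ω * Γ.base (LinearMap.mul' k A t)
      + (-1) ^ m * (ω * (Γ.d (Γ.base (LinearMap.mul' k A t)) - Γ.leftD t)) := by
  induction t using TensorProduct.induction_on with
  | zero => simp
  | tmul y z =>
    rw [spencerAux_tmul, Γ.leibniz m _ _ hω, LinearMap.mul'_apply, d_base_mul, leftD_tmul, map_mul]
    simp only [add_sub_cancel_right, add_mul, mul_assoc]
  | add s t hs ht => simp only [map_add, hs, ht, mul_add, mul_sub]; abel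

theorem spencerAux_mem {m : ℕ} {ω : Ω} (hω : ω ∈ Γ.gr m) (t : A ⊗[k] A) :
    Γ.spencerAux ω t ∈ Γ.gr (m + 1) := by
  induction t using TensorProduct.induction_on with
  | zero => simp
  | tmul y z => exact Γ.mul_base_mem z (Γ.d_mem _ _ (Γ.mul_base_mem y hω))
  | add s t hs ht => rw [map_add]; exact add_mem hs ht

theorem spencerAux_eq_zero {m : ℕ} {ω : Ω} (hω : ω ∈ Γ.gr m) {t : A ⊗[k] A}
    (ht : t ∈ Γ.jetRel) : Γ.spencerAux ω t = 0 := by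
  rw [Γ.spencerAux_eq hω, ht.1, ht.2]; simp

/-- The pairing `Ωᵐ × J¹A → Ωᵐ⁺¹`, `(ω, [y ⊗ z]) ↦ d(ωy) z`. -/
def spencerPair (m : ℕ) : Γ.Form m →+ Γ.JetA →+ Γ.Form (m + 1) :=
  AddMonoidHom.mk' (fun ω => QuotientAddGroup.lift Γ.jetRel.toAddSubgroup
      (AddMonoidHom.mk' (fun t => Form.of Γ (Γ.spencerAux (Form.val Γ ω) t)
        (Γ.spencerAux_mem (Form.val_mem Γ ω) t)) (fun s t => Form.ext Γ (by simp)))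
      (fun _ ht => Form.ext Γ (by simp [Γ.spencerAux_eq_zero (Form.val_mem Γ ω) ht])))
    (fun ω ω' => by
      ext t
      obtain ⟨t, rfl⟩ := JetA.mk_surjective Γ t
      refine Form.ext Γ ?_
      change Γ.spencerAux (Form.val Γ (ω + ω')) t
        = Γ.spencerAux (Form.val Γ ω) t + Γ.spencerAux (Form.val Γ ω') t
      induction t using TensorProduct.induction_on with
      | zero => simp
      | tmul y z => simp [add_mul]
      | add s t hs ht => simp only [map_add] at hs ht ⊢; rw [hs, ht]; abel)

theorem val_spencerPair (m : ℕ) (ω : Γ.Form m) (t : A ⊗[k] A) :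
    Form.val Γ (Γ.spencerPair m ω (JetA.mk Γ t)) = Γ.spencerAux (Form.val Γ ω) t := rfl

theorem spencerPair_op_smul (m : ℕ) (ω : Γ.Form m) (c : A) (t : Γ.JetA) :
    Γ.spencerPair m ω (MulOpposite.op c • t) = MulOpposite.op c • Γ.spencerPair m ω t := by
  induction t using JetA.induction with
  | h0 => simp
  | ht a b =>
    refine Form.ext Γ ?_
    rw [JetA.op_smul_mk, val_spencerPair, Form.val_op_smul, val_spencerPair]
    simp [mul_assoc]
  | ha s t hs ht => rw [smul_add, map_add, hs, ht, map_add, smul_add]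

theorem spencerPair_balanced (m : ℕ) (ω : Γ.Form m) (a : A) (t : Γ.JetA) :
    Γ.spencerPair m (MulOpposite.op a • ω) t = Γ.spencerPair m ω (a • t) := by
  induction t using JetA.induction with
  | h0 => simp
  | ht b c =>
    refine Form.ext Γ ?_
    rw [← map_smul, val_spencerPair, val_spencerPair]
    simp [mul_assoc, TensorProduct.smul_tmul']
  | ha s t hs ht => rw [smul_add, map_add, hs, ht, map_add]

/-- The map `J¹M → Ωᵐ⁺¹ ⊗_A M`, `[y ⊗ z] ⊗ e ↦ d(ωy) z ⊗ e`, for a fixed `m`-form `ω`. -/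
def spencerFix (m : ℕ) (M : Type y) [AddCommGroup M] [Module A M] (ω : Γ.Form m) :
    Γ.J1 M →+ BTensor A (Γ.Form (m + 1)) M :=
  BTensor.lift ((BTensor.mk A (Γ.Form (m + 1)) M).comp (Γ.spencerPair m ω)) (fun t a m' => by
    simp only [AddMonoidHom.comp_apply, BTensor.mk_apply, spencerPair_op_smul,
      BTensor.op_smul_tmul])

@[simp] theorem spencerFix_tmul (m : ℕ) (ω : Γ.Form m) (t : Γ.JetA) (e : M) :
    Γ.spencerFix m M ω (BTensor.tmul t e) = BTensor.tmul (Γ.spencerPair m ω t) e := by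
  rw [spencerFix]
  exact Eq.trans (BTensor.lift_tmul _ _ _ _) rfl

/-- The Spencer operator `Ωᵐ ⊗_A J¹M → Ωᵐ⁺¹ ⊗_A M`,
`ω ⊗ [y ⊗ z] ⊗ e ↦ d(ωy) z ⊗ e`. -/
def spencer (m : ℕ) (M : Type y) [AddCommGroup M] [Module A M] :
    BTensor A (Γ.Form m) (Γ.J1 M) →+ BTensor A (Γ.Form (m + 1)) M :=
  BTensor.lift (AddMonoidHom.mk' (Γ.spencerFix m M) (fun ω ω' => by
      ext t
      induction t using BTensor.induction with
      | h0 => simp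
      | ht t e => simp [BTensor.add_tmul]
      | ha s t hs ht => rw [map_add, hs, ht, map_add]))
    (fun ω a t => by
      change Γ.spencerFix m M (MulOpposite.op a • ω) t = Γ.spencerFix m M ω (a • t)
      induction t using BTensor.induction with
      | h0 => simp
      | ht t e => rw [BTensor.smul_tmul]; simp [spencerPair_balanced]
      | ha s t hs ht => rw [map_add, hs, ht, smul_add, map_add])

theorem spencer_tmul (m : ℕ) (ω : Γ.Form m) (t : Γ.J1 M) :
    Γ.spencer m M (BTensor.tmul ω t) = Γ.spencerFix m M ω t := by
  rw [spencer, BTensor.lift_tmul]; rfl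

/-- The unit of `Ω`, as a `0`-form. -/
def oneForm : Γ.Form 0 := Form.of Γ 1 (Γ.gradedMonoid.one_mem)

/-- The Spencer operator `J¹M → Ω¹ ⊗_A M`, `[y ⊗ z] ⊗ e ↦ (dy) z ⊗ e`. -/
def spencer0 (M : Type y) [AddCommGroup M] [Module A M] :
    Γ.J1 M →+ BTensor A (Γ.Form 1) M :=
  (Γ.spencer 0 M).comp (BTensor.mk A (Γ.Form 0) (Γ.J1 M) Γ.oneForm)

theorem spencer0_smul_j1 (a : A) (m : M) :
    Γ.spencer0 M (a • Γ.j1 M m) = BTensor.tmul (Γ.dForm a) m := by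
  change Γ.spencer 0 M (BTensor.tmul Γ.oneForm (a • BTensor.tmul (JetA.mk Γ (1 ⊗ₜ 1)) m)) = _
  rw [spencer_tmul, BTensor.smul_tmul, ← map_smul, spencerFix_tmul]
  congr 1
  refine Form.ext Γ ?_
  rw [val_spencerPair]
  simp [TensorProduct.smul_tmul', oneForm]

theorem spencer0_smul (a : A) (t : Γ.J1 M) : Γ.spencer0 M (a • t)
    = a • Γ.spencer0 M t + BTensor.tmul (Γ.dForm a) (Γ.proj M t) := by
  induction t using J1.induction with
  | h0 => simp [← BTensor.mk_apply]
  | ht b m =>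
    rw [smul_smul, spencer0_smul_j1, spencer0_smul_j1, map_smul, proj_j1, BTensor.smul_tmul,
      ← BTensor.op_smul_tmul, ← BTensor.add_tmul]
    congr 1
    refine Form.ext Γ ?_
    simp only [val_dForm, map_add, Form.val_smul, Form.val_op_smul, d_base_mul]
    abel
  | ha s t hs ht => simp only [smul_add, map_add, hs, ht, BTensor.tmul_add]; abel

/-- The map `J¹A → Ω¹`, `[a ⊗ b] ↦ a db`. -/
def JetA.leftD : Γ.JetA →+ Γ.Form 1 :=
  QuotientAddGroup.lift Γ.jetRel.toAddSubgroup
    (AddMonoidHom.mk' (fun t => Form.of Γ (Γ.leftD t) (by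
        induction t using TensorProduct.induction_on with
        | zero => simp
        | tmul y z => exact Γ.base_mul_mem y (Γ.d_mem _ _ (Γ.base_mem z))
        | add s t hs ht => rw [map_add]; exact add_mem hs ht))
      (fun s t => Form.ext Γ (by simp)))
    (fun _ ht => Form.ext Γ (by simp [ht.2]))

theorem JetA.val_leftD (t : A ⊗[k] A) :
    Form.val Γ (JetA.leftD Γ (JetA.mk Γ t)) = Γ.leftD t := rfl

theorem JetA.leftD_op_smul (c : A) (t : Γ.JetA) : JetA.leftD Γ (MulOpposite.op c • t)
    = MulOpposite.op c • JetA.leftD Γ t + JetA.proj Γ t • Γ.dForm c := by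
  obtain ⟨t, rfl⟩ := JetA.mk_surjective Γ t
  exact Form.ext Γ (Γ.leftD_rmul c t)

/-- The first component `𝔇ᴵ : J¹J¹M → Ω¹ ⊗_A M`, `[a ⊗ b] ⊗ [c ⊗ f] ⊗ e ↦ a d(bc) f ⊗ e`: the
`A`-linear lift of the Spencer operator `J¹M → Ω¹ ⊗_A M`, written on `t ⊗ x` with `t = [a ⊗ b]` as
`ab S(x) + (a db) ⊗ π^{1,0}(x)`. -/
def holI (M : Type y) [AddCommGroup M] [Module A M] :
    Γ.J1 (Γ.J1 M) →+ BTensor A (Γ.Form 1) M :=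
  BTensor.lift (AddMonoidHom.mk'
      (fun t => ((smulAddHom A _) (JetA.proj Γ t)).comp (Γ.spencer0 M)
        + (BTensor.mk A (Γ.Form 1) M (JetA.leftD Γ t)).comp (Γ.proj M).toAddMonoidHom)
      (fun s t => by ext x; simp; abel))
    (fun t a x => by
      simp only [AddMonoidHom.mk'_apply, AddMonoidHom.add_apply, AddMonoidHom.comp_apply,
        smulAddHom_apply, BTensor.mk_apply, LinearMap.toAddMonoidHom_coe, JetA.proj_op_smul,
        JetA.leftD_op_smul, spencer0_smul, map_smul, BTensor.add_tmul, BTensor.op_smul_tmul,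
        smul_add, mul_smul, BTensor.smul_tmul]
      abel)

theorem holI_tmul (t : Γ.JetA) (x : Γ.J1 M) : Γ.holI M (BTensor.tmul t x)
    = JetA.proj Γ t • Γ.spencer0 M x + BTensor.tmul (JetA.leftD Γ t) (Γ.proj M x) := by
  rw [holI, BTensor.lift_tmul]; rfl

theorem holI_smul_j1 (a : A) (x : Γ.J1 M) :
    Γ.holI M (a • Γ.j1 _ x) = a • Γ.spencer0 M x := by
  change Γ.holI M (a • BTensor.tmul (JetA.mk Γ (1 ⊗ₜ 1)) x) = _
  rw [BTensor.smul_tmul, ← map_smul, holI_tmul]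
  have : JetA.leftD Γ (JetA.mk Γ (a • 1 ⊗ₜ 1)) = 0 :=
    Form.ext Γ (by rw [JetA.val_leftD]; simp [TensorProduct.smul_tmul', d_one])
  rw [this, ← BTensor.mk_apply, map_zero, AddMonoidHom.zero_apply, add_zero]
  simp [TensorProduct.smul_tmul']

/-- The explicit formula for `𝔇ᴵ`. -/
theorem holI_apply (a b c f : A) (e : M) :
    Γ.holI M (BTensor.tmul (JetA.mk Γ (a ⊗ₜ b)) (BTensor.tmul (JetA.mk Γ (c ⊗ₜ f)) e))
      = BTensor.tmul (a • MulOpposite.op f • Γ.dForm (b * c)) e := by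
  rw [tmul_eq, tmul_eq, smul_smul, holI_smul_j1, spencer0_smul_j1, BTensor.smul_tmul,
    ← BTensor.op_smul_tmul, smul_comm a (MulOpposite.op f)]

/-- The second component `𝔇ᴵᴵ : J¹J¹M → Ω² ⊗_A M`, minus the composition of two Spencer operators,
that is `[a ⊗ b] ⊗ [c ⊗ f] ⊗ e ↦ (da ∧ d(bc)) f ⊗ e`. -/
def holII (M : Type y) [AddCommGroup M] [Module A M] :
    Γ.J1 (Γ.J1 M) →+ BTensor A (Γ.Form 2) M :=
  -(Γ.spencer 1 M).comp (Γ.spencer0 (Γ.J1 M))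

/-- The product `Ω¹ × Ω¹ → Ω²`. -/
def wedge (ω η : Γ.Form 1) : Γ.Form 2 :=
  Form.of Γ (Form.val Γ ω * Form.val Γ η)
    (Γ.gradedMonoid.mul_mem (Form.val_mem Γ ω) (Form.val_mem Γ η))

/-- Left multiplication by a `1`-form, `Ω¹ ⊗_A M → Ω² ⊗_A M`. -/
def wedgeLeft (ω : Γ.Form 1) (M : Type y) [AddCommGroup M] [Module A M] :
    BTensor A (Γ.Form 1) M →+ BTensor A (Γ.Form 2) M :=
  BTensor.lift ((BTensor.mk A (Γ.Form 2) M).comp (AddMonoidHom.mk' (Γ.wedge ω)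
      (fun η η' => Form.ext Γ (by simp [wedge, mul_add]))))
    (fun η a m => by
      change BTensor.tmul (Γ.wedge ω (MulOpposite.op a • η)) m = BTensor.tmul (Γ.wedge ω η) (a • m)
      rw [← BTensor.op_smul_tmul]
      congr 1
      exact Form.ext Γ (by simp [wedge, mul_assoc]))

theorem wedgeLeft_tmul (ω η : Γ.Form 1) (m : M) :
    Γ.wedgeLeft ω M (BTensor.tmul η m) = BTensor.tmul (Γ.wedge ω η) m := by
  rw [wedgeLeft, BTensor.lift_tmul]; rfl

theorem holII_smul_j1_smul_j1 (a b : A) (m : M) : Γ.holII M (a • Γ.j1 _ (b • Γ.j1 M m))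
    = BTensor.tmul (Γ.wedge (Γ.dForm a) (Γ.dForm b)) m := by
  change -Γ.spencer 1 M (Γ.spencer0 (Γ.J1 M) (a • Γ.j1 _ (b • Γ.j1 M m))) = _
  rw [spencer0_smul_j1, spencer_tmul]
  change -Γ.spencerFix 1 M _ (b • BTensor.tmul (JetA.mk Γ (1 ⊗ₜ 1)) m) = _
  rw [BTensor.smul_tmul, ← map_smul, spencerFix_tmul, neg_eq_iff_eq_neg, ← BTensor.mk_apply,
    ← BTensor.mk_apply, ← AddMonoidHom.neg_apply, ← map_neg]
  congr 2
  refine Form.ext Γ ?_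
  rw [val_spencerPair, map_neg]
  have := Γ.leibniz 1 _ (Γ.base b) (Γ.d_mem 0 _ (Γ.base_mem a))
  simp only [d_d, zero_mul, zero_add, pow_one, neg_one_mul] at this
  simp [TensorProduct.smul_tmul', wedge, this]

/-- The explicit formula for `𝔇ᴵᴵ`. -/
theorem holII_apply (a b c f : A) (e : M) :
    Γ.holII M (BTensor.tmul (JetA.mk Γ (a ⊗ₜ b)) (BTensor.tmul (JetA.mk Γ (c ⊗ₜ f)) e))
      = BTensor.tmul (MulOpposite.op f • Γ.wedge (Γ.dForm a) (Γ.dForm (b * c))) e := by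
  rw [tmul_eq, tmul_eq, smul_smul, holII_smul_j1_smul_j1, BTensor.op_smul_tmul]

theorem J1.induction₂ {p : Γ.J1 (Γ.J1 M) → Prop} (h0 : p 0)
    (ht : ∀ (a b : A) (m : M), p (a • Γ.j1 _ (b • Γ.j1 M m)))
    (ha : ∀ s t, p s → p t → p (s + t)) (t : Γ.J1 (Γ.J1 M)) : p t := by
  induction t using J1.induction with
  | h0 => exact h0
  | ht a x =>
    induction x using J1.induction with
    | h0 => rw [map_zero, smul_zero]; exact h0
    | ht b m => exact ht a b m
    | ha s t hs ht => rw [map_add, smul_add]; exact ha _ _ hs ht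
  | ha s t hs ht => exact ha _ _ hs ht

theorem holI_smul (a : A) (x : Γ.J1 (Γ.J1 M)) : Γ.holI M (a • x) = a • Γ.holI M x := by
  induction x using J1.induction with
  | h0 => simp
  | ht b x => rw [smul_smul, holI_smul_j1, holI_smul_j1, mul_smul]
  | ha s t hs ht => rw [smul_add, map_add, hs, ht, map_add, smul_add]

theorem holII_smul (a : A) (x : Γ.J1 (Γ.J1 M)) :
    Γ.holII M (a • x) = a • Γ.holII M x + Γ.wedgeLeft (Γ.dForm a) M (Γ.holI M x) := by
  induction x using J1.induction₂ with
  | h0 => simp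
  | ht b c m =>
    rw [smul_smul, holII_smul_j1_smul_j1, holII_smul_j1_smul_j1, holI_smul_j1, spencer0_smul_j1,
      BTensor.smul_tmul, BTensor.smul_tmul, wedgeLeft_tmul, ← BTensor.add_tmul]
    congr 1
    refine Form.ext Γ ?_
    simp only [wedge, Form.val_of, val_dForm, map_add, Form.val_smul, d_base_mul, add_mul,
      mul_assoc]
    abel
  | ha s t hs ht => simp only [smul_add, map_add, hs, ht]; abel

theorem holI_natural {N : Type x} [AddCommGroup N] [Module A N] (f : M →ₗ[A] N)
    (x : Γ.J1 (Γ.J1 M)) :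
    Γ.holI N (J1.map Γ (J1.map Γ f) x) = BTensor.map _ f (Γ.holI M x) := by
  induction x using J1.induction₂ with
  | h0 => simp
  | ht a b m =>
    rw [map_smul (J1.map Γ (J1.map Γ f)), J1.map_j1, map_smul (J1.map Γ f), J1.map_j1, holI_smul_j1, spencer0_smul_j1, holI_smul_j1,
      spencer0_smul_j1, map_smul, BTensor.map_tmul]
  | ha s t hs ht => simp only [map_add, hs, ht]

theorem holII_natural {N : Type x} [AddCommGroup N] [Module A N] (f : M →ₗ[A] N)
    (x : Γ.J1 (Γ.J1 M)) :
    Γ.holII N (J1.map Γ (J1.map Γ f) x) = BTensor.map _ f (Γ.holII M x) := by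
  induction x using J1.induction₂ with
  | h0 => simp
  | ht a b m =>
    rw [map_smul (J1.map Γ (J1.map Γ f)), J1.map_j1, map_smul (J1.map Γ f), J1.map_j1, holII_smul_j1_smul_j1, holII_smul_j1_smul_j1,
      BTensor.map_tmul]
  | ha s t hs ht => simp only [map_add, hs, ht]

theorem holI_j1_j1 (m : M) : Γ.holI M (Γ.j1 _ (Γ.j1 M m)) = 0 := by
  have := Γ.holI_smul_j1 1 (Γ.j1 M m)
  rw [one_smul, one_smul] at this
  have h2 := Γ.spencer0_smul_j1 1 m
  have h3 : Γ.dForm 1 = 0 := Form.ext Γ (by simp [d_one])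
  rw [one_smul, h3, ← BTensor.mk_apply, map_zero, AddMonoidHom.zero_apply] at h2
  rw [this, h2]

theorem holII_j1_j1 (m : M) : Γ.holII M (Γ.j1 _ (Γ.j1 M m)) = 0 := by
  have := Γ.holII_smul_j1_smul_j1 1 1 m
  have h3 : Γ.wedge (Γ.dForm 1) (Γ.dForm 1) = 0 := Form.ext Γ (by simp [wedge, d_one])
  rw [one_smul, one_smul, h3, ← BTensor.mk_apply, map_zero, AddMonoidHom.zero_apply] at this
  exact this

end ExtAlg

end Calculus

section Jets

variable {k : Type w} {A : Type u} {Ω : Type v} [CommRing k] [Ring A] [Algebra k A]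
    [Ring Ω] [Algebra k Ω] (Γ : ExtAlg k A Ω)

namespace ExtAlg

/-- For `l : Q → J¹P`, the kernel of the composition of `J¹(l) : J¹Q → J¹J¹P` with
`(𝔇ᴵ, 𝔇ᴵᴵ) : J¹J¹P → (Ω¹ ⊗_A P) × (Ω² ⊗_A P)`. -/
def holonomic {P : Type x} {Q : Type y} [AddCommGroup P] [Module A P] [AddCommGroup Q] [Module A Q]
    (l : Q →ₗ[A] Γ.J1 P) : Submodule A (Γ.J1 Q) where
  carrier := {t | Γ.holI P (J1.map Γ l t) = 0 ∧ Γ.holII P (J1.map Γ l t) = 0}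
  add_mem' {s t} hs ht := ⟨by rw [map_add, map_add, hs.1, ht.1, add_zero],
    by rw [map_add, map_add, hs.2, ht.2, add_zero]⟩
  zero_mem' := ⟨by rw [map_zero, map_zero], by rw [map_zero, map_zero]⟩
  smul_mem' a t ht := ⟨by rw [map_smul, holI_smul, ht.1, smul_zero],
    by rw [map_smul, holII_smul, ht.1, ht.2, smul_zero, map_zero, add_zero]⟩

/-- The data carried along in the recursive construction of the holonomic jets of `E`: two
consecutive jet modules `prev = JⁿE` and `cur = Jⁿ⁺¹E` with the map `l : Jⁿ⁺¹E → J¹JⁿE` and the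
prolongations of order `n` and `n + 1`. -/
structure JetStage (E : Type u) [AddCommGroup E] [Module A E] where
  prev : Type u
  [prevGroup : AddCommGroup prev]
  [prevModule : Module A prev]
  cur : Type u
  [curGroup : AddCommGroup cur]
  [curModule : Module A cur]
  l : cur →ₗ[A] Γ.J1 prev
  jprev : E →+ prev
  jcur : E →+ cur
  l_jcur : ∀ e, l (jcur e) = Γ.j1 prev (jprev e)

attribute [instance] JetStage.prevGroup JetStage.prevModule JetStage.curGroup JetStage.curModule

variable (E : Type u) [AddCommGroup E] [Module A E]

/-- The initial stage: `J⁰E = E`, `J¹E`, and `l = id`. -/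
def JetStage.zero : Γ.JetStage E where
  prev := E
  cur := Γ.J1 E
  l := LinearMap.id
  jprev := AddMonoidHom.id E
  jcur := Γ.j1 E
  l_jcur _ := rfl

variable {E} in
theorem JetStage.j1_mem (S : Γ.JetStage E) (e : E) :
    Γ.j1 S.cur (S.jcur e) ∈ Γ.holonomic S.l := by
  constructor
  · rw [J1.map_j1, S.l_jcur, holI_j1_j1]
  · rw [J1.map_j1, S.l_jcur, holII_j1_j1]

variable {E} in
/-- The next stage: `Jⁿ⁺²E` is the kernel of `(𝔇ᴵ, 𝔇ᴵᴵ) ∘ J¹(l)` on `J¹Jⁿ⁺¹E`. -/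
def JetStage.succ (S : Γ.JetStage E) : Γ.JetStage E where
  prev := S.cur
  cur := ↥(Γ.holonomic S.l)
  l := (Γ.holonomic S.l).subtype
  jprev := S.jcur
  jcur := AddMonoidHom.mk' (fun e => ⟨Γ.j1 S.cur (S.jcur e), S.j1_mem Γ e⟩)
    (fun e e' => Subtype.ext (by simp))
  l_jcur _ := rfl

/-- The stages of the construction. -/
def jetStage : ℕ → Γ.JetStage E
  | 0 => JetStage.zero Γ E
  | n + 1 => (jetStage n).succ

/-- The holonomic `n`-jet module `JⁿE`. -/
def Jet (n : ℕ) : Type u := (Γ.jetStage E n).prev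

instance (n : ℕ) : AddCommGroup (Γ.Jet E n) := inferInstanceAs (AddCommGroup (Γ.jetStage E n).prev)

instance (n : ℕ) : Module A (Γ.Jet E n) := inferInstanceAs (Module A (Γ.jetStage E n).prev)

/-- The `n`-jet prolongation `jⁿ : E → JⁿE`. -/
def jet (n : ℕ) : E →+ Γ.Jet E n := (Γ.jetStage E n).jprev

variable {E} in
/-- The jet projection `π^{n+1,n} = π^{1,0} ∘ l : Jⁿ⁺¹E → JⁿE`. -/
def JetStage.proj (S : Γ.JetStage E) : S.cur →ₗ[A] S.prev := Γ.proj S.prev ∘ₗ S.l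

variable {E} in
theorem JetStage.proj_jcur (S : Γ.JetStage E) (e : E) : S.proj Γ (S.jcur e) = S.jprev e := by
  change Γ.proj S.prev (S.l (S.jcur e)) = _
  rw [S.l_jcur, proj_j1]

/-- The jet projection `π^{n+1,n} : Jⁿ⁺¹E → JⁿE`. -/
def jetProj (n : ℕ) : Γ.Jet E (n + 1) →ₗ[A] Γ.Jet E n := (Γ.jetStage E n).proj Γ

theorem jetProj_jet (n : ℕ) (e : E) : Γ.jetProj E n (Γ.jet E (n + 1) e) = Γ.jet E n e :=
  (Γ.jetStage E n).proj_jcur Γ e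

variable {E} in
/-- A pair of maps between two stages that is compatible with the maps `l` and that covers
`Δ : E → F` along the prolongations. -/
def JetStage.Prolongs {F : Type u} [AddCommGroup F] [Module A F] (Δ : E → F)
    (S : Γ.JetStage E) (T : Γ.JetStage F) : Prop :=
  ∃ (g : S.prev →ₗ[A] T.prev) (g' : S.cur →ₗ[A] T.cur),
    (∀ e, g (S.jprev e) = T.jprev (Δ e)) ∧ (∀ e, g' (S.jcur e) = T.jcur (Δ e)) ∧
    ∀ t, T.l (g' t) = J1.map Γ g (S.l t)

variable {E} in
theorem JetStage.Prolongs.succ {F : Type u} [AddCommGroup F] [Module A F] {Δ : E → F}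
    {S : Γ.JetStage E} {T : Γ.JetStage F} (h : JetStage.Prolongs Γ Δ S T) :
    JetStage.Prolongs Γ Δ S.succ T.succ := by
  obtain ⟨g, g', -, hg', hl⟩ := h
  have hmap : ∀ t, J1.map Γ T.l (J1.map Γ g' t) = J1.map Γ (J1.map Γ g) (J1.map Γ S.l t) := by
    intro t
    have h : J1.map Γ T.l ∘ₗ J1.map Γ g' = J1.map Γ (J1.map Γ g) ∘ₗ J1.map Γ S.l :=
      J1.hom_ext Γ (fun e => by simp only [LinearMap.comp_apply, J1.map_j1, hl])
    exact LinearMap.congr_fun h t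
  have hmem : ∀ t : ↥(Γ.holonomic S.l), J1.map Γ g' t ∈ Γ.holonomic T.l := by
    intro t
    constructor
    · rw [hmap, holI_natural, t.2.1, map_zero]
    · rw [hmap, holII_natural, t.2.2, map_zero]
  refine ⟨g', LinearMap.codRestrict (Γ.holonomic T.l)
    (J1.map Γ g' ∘ₗ (Γ.holonomic S.l).subtype) hmem, hg', fun e => ?_, fun t => rfl⟩
  refine Subtype.ext ?_
  change J1.map Γ g' (Γ.j1 S.cur (S.jcur e)) = Γ.j1 T.cur (T.jcur (Δ e))
  rw [J1.map_j1, hg']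

/-- An `A`-linear map `f : JⁿE → F` prolongs to `Jⁿ⁺ᵐE → JᵐF`. -/
theorem exists_prolongation {F : Type u} [AddCommGroup F] [Module A F] (n : ℕ)
    (f : Γ.Jet E n →ₗ[A] F) (m : ℕ) :
    ∃ g : Γ.Jet E (n + m) →ₗ[A] Γ.Jet F m,
      ∀ e, g (Γ.jet E (n + m) e) = Γ.jet F m (f (Γ.jet E n e)) := by
  have key : JetStage.Prolongs Γ (fun e => f (Γ.jet E n e)) (Γ.jetStage E (n + m))
      (Γ.jetStage F m) := by
    induction m with
    | zero =>
      refine ⟨f, J1.map Γ f ∘ₗ (Γ.jetStage E n).l, fun e => rfl, fun e => ?_, fun t => rfl⟩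
      change J1.map Γ f ((Γ.jetStage E n).l ((Γ.jetStage E n).jcur e)) = Γ.j1 F _
      rw [JetStage.l_jcur]
      exact J1.map_j1 Γ f _
    | succ m ih => exact ih.succ
  obtain ⟨g, -, hg, -⟩ := key
  exact ⟨g, hg⟩

end ExtAlg

end Jets

section Operators

variable {k : Type w} {A : Type u} {Ω : Type v} [CommRing k] [Ring A] [Algebra k A]
    [Ring Ω] [Algebra k Ω] (Γ : ExtAlg k A Ω)
    (E : Type u) [AddCommGroup E] [Module k E] [Module A E] [IsScalarTower k A E]
    (F : Type u) [AddCommGroup F] [Module k F] [Module A F] [IsScalarTower k A F]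
    (G : Type u) [AddCommGroup G] [Module k G] [Module A G] [IsScalarTower k A G]

namespace ExtAlg

/-- The linear differential operators `E → F` of order at most `n`: the `k`-linear maps that factor
as `Δ̃ ∘ jⁿ` with `Δ̃ : JⁿE → F` an `A`-linear map. -/
def Diff (n : ℕ) : Submodule k (E →ₗ[k] F) where
  carrier := {Δ | ∃ Δ' : Γ.Jet E n →ₗ[A] F, ∀ e, Δ' (Γ.jet E n e) = Δ e}
  add_mem' := by
    rintro Δ₁ Δ₂ ⟨f, hf⟩ ⟨g, hg⟩
    exact ⟨f + g, fun e => by simp [hf, hg]⟩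
  zero_mem' := ⟨0, fun e => rfl⟩
  smul_mem' := by
    rintro c Δ ⟨f, hf⟩
    refine ⟨(c • LinearMap.id : F →ₗ[A] F) ∘ₗ f, fun e => by simp [hf]⟩

theorem Diff_le_succ (n : ℕ) : Γ.Diff E F n ≤ Γ.Diff E F (n + 1) := by
  rintro Δ ⟨f, hf⟩
  exact ⟨f ∘ₗ Γ.jetProj E n, fun e => by rw [LinearMap.comp_apply, jetProj_jet, hf]⟩

theorem Diff_mono {n m : ℕ} (h : n ≤ m) : Γ.Diff E F n ≤ Γ.Diff E F m :=
  monotone_nat_of_le_succ (Γ.Diff_le_succ E F) h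

variable {E F G} in
theorem comp_mem_Diff {n m : ℕ} {Δ₂ : F →ₗ[k] G} {Δ₁ : E →ₗ[k] F} (h₂ : Δ₂ ∈ Γ.Diff F G n)
    (h₁ : Δ₁ ∈ Γ.Diff E F m) : Δ₂ ∘ₗ Δ₁ ∈ Γ.Diff E G (n + m) := by
  obtain ⟨f₂, hf₂⟩ := h₂
  obtain ⟨f₁, hf₁⟩ := h₁
  obtain ⟨g, hg⟩ := Γ.exists_prolongation E m f₁ n
  rw [add_comm n m]
  exact ⟨f₂ ∘ₗ g, fun e => by simp [hg, hf₁, hf₂]⟩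

variable {E F} in
/-- An `A`-linear map is a differential operator of order at most `0`. -/
theorem linear_mem_Diff (φ : E →ₗ[A] F) {Δ : E →ₗ[k] F} (h : ∀ e, Δ e = φ e) :
    Δ ∈ Γ.Diff E F 0 :=
  ⟨φ, fun e => (h e).symm⟩

/-- The differential operators of order strictly less than `n`. -/
def DiffLT : ℕ → Submodule k (E →ₗ[k] F)
  | 0 => ⊥
  | n + 1 => Γ.Diff E F n

/-- The module of symbols of order `n`, `Diffⁿ(E, F) / Diffⁿ⁻¹(E, F)` (with `Diff⁻¹ = 0`). -/
def Symb (n : ℕ) : Type u :=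
  ↥(Γ.Diff E F n) ⧸ (Γ.DiffLT E F n).submoduleOf (Γ.Diff E F n)

instance (n : ℕ) : AddCommGroup (Γ.Symb E F n) :=
  inferInstanceAs (AddCommGroup (↥(Γ.Diff E F n) ⧸ (Γ.DiffLT E F n).submoduleOf (Γ.Diff E F n)))

instance (n : ℕ) : Module k (Γ.Symb E F n) :=
  inferInstanceAs (Module k (↥(Γ.Diff E F n) ⧸ (Γ.DiffLT E F n).submoduleOf (Γ.Diff E F n)))

/-- The symbol projection `ςⁿ : Diffⁿ(E, F) → Symbⁿ(E, F)`. -/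
def symb (n : ℕ) : ↥(Γ.Diff E F n) →ₗ[k] Γ.Symb E F n :=
  ((Γ.DiffLT E F n).submoduleOf (Γ.Diff E F n)).mkQ

theorem symb_surjective (n : ℕ) : Function.Surjective (Γ.symb E F n) :=
  Submodule.mkQ_surjective _

theorem symb_eq_zero_iff (n : ℕ) (Δ : ↥(Γ.Diff E F n)) :
    Γ.symb E F n Δ = 0 ↔ (Δ : E →ₗ[k] F) ∈ Γ.DiffLT E F n :=
  Submodule.Quotient.mk_eq_zero _

/-- The symbols of all orders, `Symb•(E, F) = ⨁ₙ Symbⁿ(E, F)`. -/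
abbrev SymbAll : Type u := ⨁ n, Γ.Symb E F n

variable {E F} in
theorem comp_mem_DiffLT_left {φ : F →ₗ[k] G} (hφ : φ ∈ Γ.Diff F G 0) {n : ℕ} {Δ : E →ₗ[k] F}
    (h : Δ ∈ Γ.DiffLT E F n) : φ ∘ₗ Δ ∈ Γ.DiffLT E G n := by
  cases n with
  | zero =>
    rw [DiffLT, Submodule.mem_bot] at h ⊢
    rw [h, LinearMap.comp_zero]
  | succ n =>
    have := Γ.comp_mem_Diff hφ h
    rwa [zero_add] at this

/-- The action of `φ ∈ _AHom(F, F)` on `Diffⁿ(E, F)`, `Δ ↦ φ ∘ Δ`. -/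
def postDiff (φ : F →ₗ[A] F) (n : ℕ) : ↥(Γ.Diff E F n) →ₗ[k] ↥(Γ.Diff E F n) :=
  (LinearMap.compRight k (M := E) (φ.restrictScalars k)).restrict (fun Δ hΔ => by
    have := Γ.comp_mem_Diff (Γ.linear_mem_Diff (Δ := φ.restrictScalars k) φ (fun _ => rfl)) hΔ
    rwa [zero_add] at this)

theorem coe_postDiff (φ : F →ₗ[A] F) (n : ℕ) (Δ : ↥(Γ.Diff E F n)) :
    (Γ.postDiff E F φ n Δ : E →ₗ[k] F) = φ.restrictScalars k ∘ₗ (Δ : E →ₗ[k] F) := rfl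

/-- The action of `φ ∈ _AHom(F, F)` on `Symbⁿ(E, F)`, `ςⁿ(Δ) ↦ ςⁿ(φ ∘ Δ)`. -/
def postSymb (φ : F →ₗ[A] F) (n : ℕ) : Γ.Symb E F n →ₗ[k] Γ.Symb E F n :=
  Submodule.mapQ _ _ (Γ.postDiff E F φ n) (fun _ hΔ =>
    Γ.comp_mem_DiffLT_left F (Γ.linear_mem_Diff (Δ := φ.restrictScalars k) φ (fun _ => rfl)) hΔ)

theorem postSymb_symb (φ : F →ₗ[A] F) (n : ℕ) (Δ : ↥(Γ.Diff E F n)) :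
    Γ.postSymb E F φ n (Γ.symb E F n Δ) = Γ.symb E F n (Γ.postDiff E F φ n Δ) := rfl

/-- The algebra `Diff(E, E)` of linear differential operators of finite order, under
composition. -/
def DiffAlg : Subalgebra k (Module.End k E) where
  carrier := {Δ | ∃ n, Δ ∈ Γ.Diff E E n}
  mul_mem' := by
    rintro Δ₁ Δ₂ ⟨n, h₁⟩ ⟨m, h₂⟩
    exact ⟨n + m, Γ.comp_mem_Diff h₁ h₂⟩
  add_mem' := by
    rintro Δ₁ Δ₂ ⟨n, h₁⟩ ⟨m, h₂⟩
    exact ⟨max n m, add_mem (Γ.Diff_mono E E (le_max_left n m) h₁)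
      (Γ.Diff_mono E E (le_max_right n m) h₂)⟩
  algebraMap_mem' c := ⟨0, Γ.linear_mem_Diff (c • LinearMap.id) (fun _ => rfl)⟩

/-- The inclusion `Diffⁿ(E, E) → Diff(E, E)`. -/
def toDiffAlg (n : ℕ) : ↥(Γ.Diff E E n) →ₗ[k] ↥(Γ.DiffAlg E) where
  toFun Δ := ⟨Δ, n, Δ.2⟩
  map_add' _ _ := rfl
  map_smul' _ _ := rfl

@[simp] theorem coe_toDiffAlg (n : ℕ) (Δ : ↥(Γ.Diff E E n)) :
    (Γ.toDiffAlg E n Δ : E →ₗ[k] E) = Δ := rfl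

/-- Composition `Diffⁿ(E, E) × Diffᵐ(E, E) → Diffⁿ⁺ᵐ(E, E)`, `(Δ₁, Δ₂) ↦ Δ₁ ∘ Δ₂`. -/
def compDiff (n m : ℕ) :
    ↥(Γ.Diff E E n) →ₗ[k] ↥(Γ.Diff E E m) →ₗ[k] ↥(Γ.Diff E E (n + m)) :=
  LinearMap.mk₂ k (fun Δ₁ Δ₂ => ⟨(Δ₁ : E →ₗ[k] E) ∘ₗ (Δ₂ : E →ₗ[k] E),
      Γ.comp_mem_Diff Δ₁.2 Δ₂.2⟩)
    (fun _ _ _ => Subtype.ext (LinearMap.add_comp _ _ _))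
    (fun _ _ _ => Subtype.ext (LinearMap.smul_comp _ _ _))
    (fun _ _ _ => Subtype.ext (LinearMap.comp_add _ _ _))
    (fun _ _ _ => Subtype.ext (LinearMap.comp_smul _ _ _))

@[simp] theorem coe_compDiff (n m : ℕ) (Δ₁ : ↥(Γ.Diff E E n)) (Δ₂ : ↥(Γ.Diff E E m)) :
    (Γ.compDiff E n m Δ₁ Δ₂ : E →ₗ[k] E) = (Δ₁ : E →ₗ[k] E) ∘ₗ (Δ₂ : E →ₗ[k] E) := rfl

variable {E} in
theorem comp_mem_DiffLT_of_left {n m : ℕ} {Δ₁ Δ₂ : E →ₗ[k] E} (h₁ : Δ₁ ∈ Γ.DiffLT E E n)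
    (h₂ : Δ₂ ∈ Γ.Diff E E m) : Δ₁ ∘ₗ Δ₂ ∈ Γ.DiffLT E E (n + m) := by
  cases n with
  | zero =>
    rw [DiffLT, Submodule.mem_bot] at h₁
    rw [h₁, LinearMap.zero_comp]
    exact zero_mem _
  | succ n =>
    rw [Nat.succ_add_eq_add_succ]
    exact Γ.comp_mem_Diff h₁ h₂

variable {E} in
theorem comp_mem_DiffLT_of_right {n m : ℕ} {Δ₁ Δ₂ : E →ₗ[k] E} (h₁ : Δ₁ ∈ Γ.Diff E E n)
    (h₂ : Δ₂ ∈ Γ.DiffLT E E m) : Δ₁ ∘ₗ Δ₂ ∈ Γ.DiffLT E E (n + m) := by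
  cases m with
  | zero =>
    rw [DiffLT, Submodule.mem_bot] at h₂
    rw [h₂, LinearMap.comp_zero]
    exact zero_mem _
  | succ m => exact Γ.comp_mem_Diff h₁ h₂

/-- The symbol multiplication on homogeneous elements, `ςⁿ(Δ₁) · ςᵐ(Δ₂) = ςⁿ⁺ᵐ(Δ₁ ∘ Δ₂)`. -/
def symbMulHom (n m : ℕ) :
    Γ.Symb E E n →ₗ[k] Γ.Symb E E m →ₗ[k] Γ.Symb E E (n + m) :=
  Submodule.liftQ _
    (LinearMap.flip (Submodule.liftQ _
      (LinearMap.flip ((Γ.compDiff E n m).compr₂ (Γ.symb E E (n + m))))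
      (fun Δ₂ h₂ => LinearMap.mem_ker.2 (LinearMap.ext fun Δ₁ =>
        (Γ.symb_eq_zero_iff E E _ _).2 (Γ.comp_mem_DiffLT_of_right Δ₁.2 h₂)))))
    (fun Δ₁ h₁ => LinearMap.mem_ker.2 (LinearMap.ext fun b => by
      obtain ⟨Δ₂, rfl⟩ := Γ.symb_surjective E E m b
      exact (Γ.symb_eq_zero_iff E E _ _).2 (Γ.comp_mem_DiffLT_of_left h₁ Δ₂.2)))

theorem symbMulHom_symb (n m : ℕ) (Δ₁ : ↥(Γ.Diff E E n)) (Δ₂ : ↥(Γ.Diff E E m)) :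
    Γ.symbMulHom E n m (Γ.symb E E n Δ₁) (Γ.symb E E m Δ₂)
      = Γ.symb E E (n + m) (Γ.compDiff E n m Δ₁ Δ₂) := rfl

/-- The bilinear operation on `Symb•(E, E)` with given values on pairs of homogeneous elements. -/
def gradedBilin (f : ∀ n m, Γ.Symb E E n →ₗ[k] Γ.Symb E E m →ₗ[k] Γ.SymbAll E E) :
    Γ.SymbAll E E →ₗ[k] Γ.SymbAll E E →ₗ[k] Γ.SymbAll E E :=
  DirectSum.toModule k ℕ (Γ.SymbAll E E →ₗ[k] Γ.SymbAll E E) (fun n =>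
    LinearMap.flip (DirectSum.toModule k ℕ (Γ.Symb E E n →ₗ[k] Γ.SymbAll E E)
      (fun m => LinearMap.flip (f n m))))

theorem gradedBilin_lof (f : ∀ n m, Γ.Symb E E n →ₗ[k] Γ.Symb E E m →ₗ[k] Γ.SymbAll E E)
    (n m : ℕ) (a : Γ.Symb E E n) (b : Γ.Symb E E m) :
    Γ.gradedBilin E f (DirectSum.lof k ℕ (Γ.Symb E E) n a) (DirectSum.lof k ℕ (Γ.Symb E E) m b)
      = f n m a b := by
  rw [gradedBilin, DirectSum.toModule_lof, LinearMap.flip_apply, DirectSum.toModule_lof,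
    LinearMap.flip_apply]

/-- The multiplication of the symbol algebra `Symb•(E, E)`. -/
def symbMul : Γ.SymbAll E E →ₗ[k] Γ.SymbAll E E →ₗ[k] Γ.SymbAll E E :=
  Γ.gradedBilin E (fun n m =>
    (Γ.symbMulHom E n m).compr₂ (DirectSum.lof k ℕ (Γ.Symb E E) (n + m)))

/-- The unit `id_E ∈ _AHom(E, E) = Symb⁰(E, E)` of the symbol algebra. -/
def symbOne : Γ.SymbAll E E :=
  DirectSum.lof k ℕ (Γ.Symb E E) 0
    (Γ.symb E E 0 ⟨LinearMap.id, Γ.linear_mem_Diff LinearMap.id (fun _ => rfl)⟩)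

/-- A (full) quantization for `(E, F)`: for every `n`, an `_AHom(F, F)`-linear section `qⁿ` of the
symbol projection `ςⁿ : Diffⁿ(E, F) → Symbⁿ(E, F)`. -/
structure Quantization where
  /-- the `n`-quantizations -/
  q : ∀ n, Γ.Symb E F n →ₗ[k] ↥(Γ.Diff E F n)
  symb_q : ∀ n (σ : Γ.Symb E F n), Γ.symb E F n (q n σ) = σ
  q_post : ∀ n (φ : F →ₗ[A] F) (σ : Γ.Symb E F n),
    q n (Γ.postSymb E F φ n σ) = Γ.postDiff E F φ n (q n σ)

namespace Quantization

variable {E F} {Γ} (q : Γ.Quantization E F) (p : Γ.Quantization E E)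

/-- `Δ ↦ Δ - qᵏ⁺¹(ςᵏ⁺¹(Δ))`, from operators of order at most `k + 1` to operators of order at
most `k`. -/
def step (i : ℕ) : ↥(Γ.Diff E F (i + 1)) →ₗ[k] ↥(Γ.Diff E F i) :=
  LinearMap.codRestrict (Γ.Diff E F i)
    ((Γ.Diff E F (i + 1)).subtype ∘ₗ (LinearMap.id - q.q (i + 1) ∘ₗ Γ.symb E F (i + 1)))
    (fun Δ => (Γ.symb_eq_zero_iff E F (i + 1) _).1 (by
      simp only [LinearMap.sub_apply, LinearMap.comp_apply, LinearMap.id_apply, map_sub, q.symb_q,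
        sub_self]))

theorem coe_step (i : ℕ) (Δ : ↥(Γ.Diff E F (i + 1))) : (q.step i Δ : E →ₗ[k] F)
    = (Δ : E →ₗ[k] F) - (q.q (i + 1) (Γ.symb E F (i + 1) Δ) : E →ₗ[k] F) := rfl

/-- The `i`-truncation of an operator `Δ` of order at most `n`: it is `Δ` for `i ≥ n`, and
recursively `T - qⁱ⁺¹(ςⁱ⁺¹(T))` for `i < n`, where `T` is the `(i+1)`-truncation of `Δ`. -/
def trunc (n i : ℕ) : ↥(Γ.Diff E F n) →ₗ[k] ↥(Γ.Diff E F i) :=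
  if h : n ≤ i then Submodule.inclusion (Γ.Diff_mono E F h)
  else q.step i ∘ₗ trunc n (i + 1)
termination_by n - i

/-- `[Δ]ⁱ`, the `i`-symbol of the `i`-truncation of an operator of order at most `n`. -/
def part (n i : ℕ) : ↥(Γ.Diff E F n) →ₗ[k] Γ.Symb E F i := Γ.symb E F i ∘ₗ q.trunc n i

/-- The full quantization `q = ∑ₙ qⁿ : Symb•(E, E) → Diff(E, E)`. -/
def full : Γ.SymbAll E E →ₗ[k] ↥(Γ.DiffAlg E) :=
  DirectSum.toModule k ℕ ↥(Γ.DiffAlg E) (fun n => Γ.toDiffAlg E n ∘ₗ p.q n)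

/-- The map `Δ ↦ ∑_{i ≤ N} ħⁱ [Δ]^{N-i}` on operators of order at most `N`. -/
def deform (ħ : k) (N : ℕ) : ↥(Γ.Diff E E N) →ₗ[k] Γ.SymbAll E E :=
  ∑ i ∈ Finset.range (N + 1),
    ħ ^ i • (DirectSum.lof k ℕ (Γ.Symb E E) (N - i) ∘ₗ p.part N (N - i))

/-- The star product `⋆_ħ` on `Symb•(E, E)`: the bilinear operation with
`a ⋆_ħ b = ∑_{i ≤ n+m} ħⁱ [qⁿ(a) ∘ qᵐ(b)]^{n+m-i}` for `a` of degree `n` and `b` of degree `m`. -/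
def star (ħ : k) : Γ.SymbAll E E →ₗ[k] Γ.SymbAll E E →ₗ[k] Γ.SymbAll E E :=
  Γ.gradedBilin E (fun n m =>
    ((Γ.compDiff E n m).compr₂ (p.deform ħ (n + m))).compl₁₂ (p.q n) (p.q m))

theorem star_lof (ħ : k) (n m : ℕ) (a : Γ.Symb E E n) (b : Γ.Symb E E m) :
    p.star ħ (DirectSum.lof k ℕ (Γ.Symb E E) n a) (DirectSum.lof k ℕ (Γ.Symb E E) m b)
      = ∑ i ∈ Finset.range (n + m + 1), ħ ^ i • DirectSum.lof k ℕ (Γ.Symb E E) (n + m - i)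
          (p.part (n + m) (n + m - i) (Γ.compDiff E n m (p.q n a) (p.q m b))) := by
  rw [star, gradedBilin_lof]
  simp [deform]

end Quantization

end ExtAlg

end Operators

end NCDiff

end

noncomputable section

open scoped TensorProduct DirectSum

namespace NCDiff.ExtAlg

variable {k : Type w} {A : Type u} {Ω : Type v} [CommRing k] [Ring A] [Algebra k A]
    [Ring Ω] [Algebra k Ω] {Γ : ExtAlg k A Ω}
    {E : Type u} [AddCommGroup E] [Module k E] [Module A E] [IsScalarTower k A E]
    {F : Type u} [AddCommGroup F] [Module k F] [Module A F] [IsScalarTower k A F]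

/-! The symbol projection `ςᴺ` has kernel the operators of order below `N`, so its section `qᴺ`
splits the filtration: every operator of order at most `N` is a quantized `N`-symbol plus an
operator of order at most `N - 1`. Iterating down to order `0`, where nothing lies below, gives a
unique finite expansion of `Δ` as a sum of quantized symbols. The truncations compute this expansion
one order at a time, and its coefficients are the parts `[Δ]ⁱ`.

Existence of the expansion is `sum_q_part`. Uniqueness is `eq_zero_of_sum_q_eq_zero`: in a vanishing
sum the top symbol must vanish, since all the other terms have lower order. Neither needs
composition, so both are proved for operators `E → F`.

For `E = F`, existence says that `deform 1`, which collects all the parts with coefficient one, is a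
right inverse of `full` (`full_deform_one`), and uniqueness says that `full` is injective. On
homogeneous elements `a ⋆₁ b` is `deform 1` applied to the operator `q(a) ∘ q(b)`, so
multiplicativity of `q` follows at once. For `ħ = 0` only the leading term `ςⁿ⁺ᵐ(qⁿ(a) ∘ qᵐ(b))`
survives; by the definition of the symbol product it is the product of `ςⁿ(qⁿ(a)) = a` and
`ςᵐ(qᵐ(b)) = b`. -/

/-- Homogeneous elements span the direct sum, so identities between bilinear maps need checking only
on them. The target `P` is left free because it is the symbols for `ħ = 0` and the operators for `ħ
= 1`. -/
theorem bilin_ext {P : Type*} [AddCommGroup P] [Module k P]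
    {f g : Γ.SymbAll E E →ₗ[k] Γ.SymbAll E E →ₗ[k] P}
    (h : ∀ n m a b, f (DirectSum.lof k ℕ (Γ.Symb E E) n a) (DirectSum.lof k ℕ (Γ.Symb E E) m b)
      = g (DirectSum.lof k ℕ (Γ.Symb E E) n a) (DirectSum.lof k ℕ (Γ.Symb E E) m b)) :
    f = g :=
  DirectSum.linearMap_ext k fun n => LinearMap.ext fun a =>
    DirectSum.linearMap_ext k fun m => LinearMap.ext fun b => h n m a b

namespace Quantization

variable (q : Γ.Quantization E F) (p : Γ.Quantization E E)

/-! ### Truncations and the expansion of an operator into quantized symbols -/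

/-- `trunc` is defined by well-founded recursion on `n - i`. This equation and `trunc_of_lt` are its
initial value and its descending recursion, and the later proofs use no others. -/
theorem trunc_self (n : ℕ) : q.trunc n n = LinearMap.id := by
  rw [trunc, dif_pos le_rfl]
  rfl

theorem trunc_of_lt {n i : ℕ} (h : i < n) : q.trunc n i = q.step i ∘ₗ q.trunc n (i + 1) := by
  rw [trunc, dif_neg h.not_ge]

theorem part_self (n : ℕ) : q.part n n = Γ.symb E F n := by
  rw [part, trunc_self, LinearMap.comp_id]

/-- An operator of order zero is recovered from its symbol, as there are no operators of negative
order. -/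
theorem q_zero_symb (Δ : ↥(Γ.Diff E F 0)) : q.q 0 (Γ.symb E F 0 Δ) = Δ := by
  have h : Γ.symb E F 0 (q.q 0 (Γ.symb E F 0 Δ) - Δ) = 0 := by
    rw [map_sub, q.symb_q, sub_self]
  rw [symb_eq_zero_iff, DiffLT, Submodule.mem_bot] at h
  exact sub_eq_zero.1 (Subtype.ext h)

/-- An operator is its `r`-truncation plus the quantizations of its symbols of order above `r`. -/
theorem trunc_add_sum (N j r : ℕ) (h : j + r = N) (Δ : ↥(Γ.Diff E F N)) :
    (q.trunc N r Δ : E →ₗ[k] F)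
      + ∑ i ∈ Finset.range j, (q.q (N - i) (q.part N (N - i) Δ) : E →ₗ[k] F) = Δ := by
  induction j generalizing r with
  | zero =>
    obtain rfl : r = N := by omega
    simp [trunc_self]
  | succ j ih =>
    -- The sum runs downwards from order `N`, so its new last term, at index `j`, has order `r + 1`.
    -- It is exactly what `step` subtracts in passing from the `(r + 1)`-truncation to the
    -- `r`-truncation, and the two cancel.
    have hr : N - j = r + 1 := by omega
    rw [← ih (r + 1) (by omega), Finset.sum_range_succ, hr, trunc_of_lt q (by omega : r < N),
      LinearMap.comp_apply, coe_step, part, LinearMap.comp_apply]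
    abel

/-- Once all positive orders have been removed, the remainder is the `0`-truncation. By
`q_zero_symb` it equals the quantization of its own symbol, so it is the term `i = N` of the sum and
nothing is left over. -/
theorem sum_q_part (N : ℕ) (Δ : ↥(Γ.Diff E F N)) :
    ∑ i ∈ Finset.range (N + 1), (q.q (N - i) (q.part N (N - i) Δ) : E →ₗ[k] F) = Δ := by
  rw [Finset.sum_range_succ, Nat.sub_self, part, LinearMap.comp_apply, q_zero_symb, add_comm]
  exact q.trunc_add_sum N N 0 (add_zero N) Δ

/-! ### Uniqueness of the expansion -/

/-- The filtration is increasing and every summand has order below `N`. With `DiffLT` the bound is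
literally membership in the kernel of `ςᴺ`, and it covers the empty sum at `N = 0`. -/
theorem sum_q_mem_DiffLT (s : ∀ n, Γ.Symb E F n) (N : ℕ) :
    ∑ i ∈ Finset.range N, (q.q i (s i) : E →ₗ[k] F) ∈ Γ.DiffLT E F N := by
  cases N with
  | zero => exact zero_mem _
  | succ N =>
    exact sum_mem fun i hi =>
      Γ.Diff_mono E F (Nat.lt_succ_iff.1 (Finset.mem_range.1 hi)) (q.q i (s i)).2

/-- A leading-term argument: applying the top symbol projection kills all terms but the last, which
it returns as `s N`. The shorter sum then vanishes too, and induction finishes. -/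
theorem eq_zero_of_sum_q_eq_zero (s : ∀ n, Γ.Symb E F n) (N : ℕ)
    (h : ∑ i ∈ Finset.range N, (q.q i (s i) : E →ₗ[k] F) = 0) : ∀ i < N, s i = 0 := by
  induction N with
  | zero => intro i hi; omega
  | succ N ih =>
    rw [Finset.sum_range_succ] at h
    have hN : s N = 0 := by
      -- Seen as the symbol of `q N (s N)`, the element `s N` vanishes as soon as that operator has
      -- order below `N`; by `h` the operator is minus the sum of the lower terms.
      rw [← q.symb_q N (s N), symb_eq_zero_iff, eq_neg_of_add_eq_zero_right h]
      exact neg_mem (q.sum_q_mem_DiffLT s N)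
    intro i hi
    rcases Nat.lt_succ_iff_lt_or_eq.1 hi with hi | rfl
    · refine ih ?_ i hi
      simpa [hN] using h
    · exact hN

/-! ### Bijectivity of the full quantization -/

@[simp] theorem full_lof (n : ℕ) (a : Γ.Symb E E n) :
    p.full (DirectSum.lof k ℕ (Γ.Symb E E) n a) = Γ.toDiffAlg E n (p.q n a) := by
  rw [full, DirectSum.toModule_lof, LinearMap.comp_apply]

/-- This is `sum_q_part` read in the direct sum, all powers of `ħ` being `1`. It yields both the
surjectivity of `full` and the multiplicativity of `⋆₁`. -/
theorem full_deform_one (N : ℕ) (Δ : ↥(Γ.Diff E E N)) :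
    p.full (p.deform 1 N Δ) = Γ.toDiffAlg E N Δ := by
  refine Subtype.ext ?_
  rw [coe_toDiffAlg, ← p.sum_q_part N Δ]
  simp [deform, LinearMap.sum_apply]

/-- Enlarging the finite support to an initial segment of degrees brings `σ` into the form that
`eq_zero_of_sum_q_eq_zero` handles. -/
theorem exists_eq_sum_lof (σ : Γ.SymbAll E E) :
    ∃ N, σ = ∑ i ∈ Finset.range N, DirectSum.lof k ℕ (Γ.Symb E E) i (σ i) := by
  classical
  obtain ⟨N, hN⟩ := (DFinsupp.support σ).exists_nat_subset_range
  refine ⟨N, ?_⟩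
  conv_lhs => rw [← DirectSum.sum_support_of σ]
  refine Finset.sum_subset hN fun i _ hi => ?_
  rw [DFinsupp.notMem_support_iff.1 hi, map_zero]

theorem full_injective : Function.Injective p.full := by
  rw [injective_iff_map_eq_zero]
  intro σ hσ
  obtain ⟨N, hN⟩ := exists_eq_sum_lof σ
  have h : ∑ i ∈ Finset.range N, (p.q i (σ i) : E →ₗ[k] E) = 0 := by
    rw [hN, map_sum] at hσ
    -- `hσ` is an equation in the subalgebra `DiffAlg`; the uniqueness lemma speaks of the
    -- underlying maps.
    simpa using congrArg Subtype.val hσ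
  rw [hN]
  refine Finset.sum_eq_zero fun i hi => ?_
  rw [p.eq_zero_of_sum_q_eq_zero (fun n => σ n) N h i (Finset.mem_range.1 hi), map_zero]

theorem full_surjective : Function.Surjective p.full := by
  rintro ⟨Δ, N, hΔ⟩
  exact ⟨p.deform 1 N ⟨Δ, hΔ⟩, p.full_deform_one N ⟨Δ, hΔ⟩⟩

/-- No normalization of `q` is needed: in order `0` the section `q⁰` is forced to be the inverse of
`ς⁰`. -/
theorem full_symbOne : p.full (Γ.symbOne E) = 1 := by
  rw [symbOne, full_lof, q_zero_symb]
  rfl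

/-! ### The star products at `ħ = 1` and `ħ = 0` -/

theorem full_star_one (a b : Γ.SymbAll E E) : p.full (p.star 1 a b) = p.full a * p.full b := by
  -- Both sides become bilinear maps into `DiffAlg`, so that `bilin_ext` reduces the claim to
  -- homogeneous `a` and `b`.
  have h : (p.star 1).compr₂ p.full
      = (LinearMap.mul k ↥(Γ.DiffAlg E)).compl₁₂ p.full p.full := by
    refine bilin_ext fun n m a b => ?_
    rw [LinearMap.compr₂_apply, LinearMap.compl₁₂_apply, star, gradedBilin_lof, full_lof, full_lof]
    exact p.full_deform_one (n + m) (Γ.compDiff E n m (p.q n a) (p.q m b))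
  exact LinearMap.congr_fun₂ h a b

theorem star_zero : p.star 0 = Γ.symbMul E := by
  refine bilin_ext fun n m a b => ?_
  -- `Finset.sum_range_succ'` splits off the index `0`, whose coefficient is `0 ^ 0 = 1`; every
  -- other coefficient is a positive power of `0`.
  rw [star_lof, Finset.sum_range_succ', Finset.sum_eq_zero (fun i _ => by simp), zero_add, pow_zero,
    one_smul, symbMul, gradedBilin_lof, LinearMap.compr₂_apply, Nat.sub_zero, part_self,
    ← symbMulHom_symb, p.symb_q, p.symb_q]

end Quantization

end NCDiff.ExtAlg

end

/-- The symbols carry `⋆₁` only as a bilinear map; its associativity and unit laws follow from those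
of composition through the bijection `Φ`. -/
theorem proposition5p41 {k : Type w} {A : Type u} {Ω : Type v} [CommRing k] [Ring A] [Algebra k A]
    [Ring Ω] [Algebra k Ω] (Γ : NCDiff.ExtAlg k A Ω)
    (E : Type u) [AddCommGroup E] [Module k E] [Module A E] [IsScalarTower k A E]
    (q : Γ.Quantization E E) :
    q.star 0 = Γ.symbMul E ∧
    ∃ Φ : Γ.SymbAll E E ≃ₗ[k] ↥(Γ.DiffAlg E),
      (∀ σ, Φ σ = q.full σ) ∧ Φ (Γ.symbOne E) = 1 ∧ ∀ a b, Φ (q.star 1 a b) = Φ a * Φ b :=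
  ⟨q.star_zero, LinearEquiv.ofBijective q.full ⟨q.full_injective, q.full_surjective⟩,
    fun _ => rfl, q.full_symbOne, q.full_star_one⟩
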